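/- Let $\Omega$ be a measurable space which also carries a Hausdorff topology, $\mu$ a probability measure on $\Omega$, $T:\Omega\to\Omega$ a measurable $\mu$-preserving map, and $\mathcal A$ a countable measurable partition of $\Omega$. Let $\mathcal A^n=\bigvee_{j=0}^{n-1}T^{-j}\mathcal A$ be its joins (whose elements are the $n$-cylinders), $A_n(x)$ the $n$-cylinder containing $x$, and assume that $\mathcal A$ is generating: $\bigcap_nA_n(x)=\{x\}$ for all $x$. Assume that $\mu$ is left $\phi$-mixing, i.e. $|\mu(A\cap T^{-n-k}B)-\mu(A)\mu(B)|\le\phi(k)\mu(A)$, or right $\phi$-mixing, i.e. the same with $\phi(k)\mu(B)$ on the right-hand side, for all $n,k$, $A\in\sigma(\mathcal A^n)$, $B\in\sigma(\bigcup_j\mathcal A^j)$, where $\phi$ is decreasing, $\phi(k)\to0$ and $\phi(k)=O(k^{-p})$. Let $x\in\Omega$ be such that every iterate $T^k$ is continuous at $x$. (For the topology generated by the cylinders this holds automatically, and there convergence of the sets $U_n$ to $x$ in (3) below means that each $A_k(x)$ contains $U_n$ for all large $n$.) For $V\in\sigma(\mathcal A^N)$ and $j\le N$ put $V^j=A_j(T^{N-j}V)$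 in the left and $V^j=A_j(V)$ in the right $\phi$-mixing case, where $A_j(W)$ is the union of all $j$-cylinders that meet $W$. If $x$ is periodic with minimal period $m$, put $U_{n,u}=\bigcap_{j=0}^uT^{-jm}U_n\in\sigma(\mathcal A^{n+um})$. Let $U_n$, $n\ge1$, be an adapted neighbourhood system at $x$, that is: 1. $U_n\in\sigma(\mathcal A^n)$; 2. $U_{n+1}\subset U_n$; 3. $\bigcap_nU_n=\{x\}$, and the sets contract to $x$: every neighbourhood of $x$ contains $U_n$ for all large $n$; 4. for some $\gamma'>0$, $K\in(0,1]$ and $C$: if $x$ is non-periodic, $\mu(U_n^j)\le Cj^{-\gamma'}$ for $1\le j\le Kn$; if $x$ is periodic with minimal period $m$, $\mu(U_{n,u}^j)\le Cj^{-\gamma'}$ for all $u\ge0$ and $1\le j\le K(n+um)$; 5. if $x$ is periodic with minimal period $m$, there are $J(n)\in(0,1)$ with $J(n)n\to\infty$ and $r_n\to0$ such that $\left|\mu\left(\bigcap_{j=0}^kT^{-i_j}U_n\right)-\mu(U_{n,i_k/m})\right|\le r_n\,\mu(U_{n,i_k/m})$ for all $n\ge1$, $k\ge0$ and all multiples $0=i_0<i_1<\dots<i_k\le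 J(n)n$ of $m$. Assume one of the following two cases. **(I)** With $\gamma'$ from (4), $1<\gamma'<\gamma''$ and $\zeta\in(0,1]$: $n^{-\gamma''}\lesssim\mu(U_n)\lesssim n^{-\gamma'}$; if $x$ is periodic, $J(n)\gtrsim n^{-(1-\zeta)}$; and $p>\max\{2,\frac{2\gamma''}{\zeta\gamma'}-1\}$. **(II)** $\gamma'>1$ in (4), and with $0<\xi_1<\xi_2<1$ and $J\in(0,1)$: $\xi_1^n\lesssim\mu(U_n)\lesssim\xi_2^n$; if $x$ is periodic, $J(n)=J$ for all $n$; and $p>\frac8J\frac{\log\xi_1}{\log\xi_2}-1$. If $x$ is periodic with minimal period $m$, assume that the limit $\vartheta(x)=\lim_n\mu(U_n\cap T^{-m}U_n)/\mu(U_n)$ exists and is less than $\frac12$; put $\vartheta(x)=0$ if $x$ is non-periodic. Let $\tau_U(y)=\inf\{j\ge1:T^jy\in U\}$, and let $\underline\rho_U$ and $\overline\rho_U$ be the lower and upper limits of $\frac1t|\log\mu(\tau_U>t)|$ as $t\to\infty$; the escape rate $\rho_U$ exists if they agree, and is then their common value. Then $$\lim_{n\to\infty}\frac{\underline\rho_{U_n}}{\mu(U_n)}=\lim_{n\to\infty}\frac{\overline\rho_{U_n}}{\mu(U_n)}=1-\vartheta(x).$$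 In particular, if $\rho_{U_n}$ exists for all large $n$, then the localised escape rate is $\rho(x)=\lim_{n\to\infty}\rho_{U_n}/\mu(U_n)=1-\vartheta(x)$. -/

import Mathlib

open MeasureTheory Filter Topology Set

namespace EscapeRate

variable {Ω : Type*}

/-- `P` is a countable measurable partition of `Ω`. -/
structure IsMeasPartition [MeasurableSpace Ω] (P : Set (Set Ω)) : Prop where
  isPartition : Setoid.IsPartition P
  countable : P.Countable
  measurable : ∀ a ∈ P, MeasurableSet a

/-- The `n`-th join `P ∨ T⁻¹ P ∨ ⋯ ∨ T^{-(n-1)} P`; its elements are the `n`-cylinders. -/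
def cylJoin (T : Ω → Ω) (P : Set (Set Ω)) (n : ℕ) : Set (Set Ω) :=
  {B | B.Nonempty ∧ ∃ a : Fin n → Set Ω, (∀ j, a j ∈ P) ∧ B = ⋂ j : Fin n, T^[(j : ℕ)] ⁻¹' (a j)}

/-- The σ-algebra generated by the `n`-cylinders. -/
abbrev sigmaCyl (T : Ω → Ω) (P : Set (Set Ω)) (n : ℕ) : MeasurableSpace Ω :=
  MeasurableSpace.generateFrom (cylJoin T P n)

/-- The σ-algebra generated by all cylinders. -/
abbrev sigmaAll (T : Ω → Ω) (P : Set (Set Ω)) : MeasurableSpace Ω :=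
  MeasurableSpace.generateFrom (⋃ n, cylJoin T P n)

/-- The `n`-cylinder containing the point `x`. -/
def cylinder (T : Ω → Ω) (P : Set (Set Ω)) (n : ℕ) (x : Ω) : Set Ω :=
  {y | ∃ B ∈ cylJoin T P n, x ∈ B ∧ y ∈ B}

/-- `P` is generating: points are determined by their cylinders. -/
def IsGenerating (T : Ω → Ω) (P : Set (Set Ω)) : Prop :=
  ∀ x, ⋂ n, cylinder T P n x = {x}

/-- The two versions of `φ`-mixing. -/
inductive Side
  | left
  | right

/-- `μ` is left, respectively right, `φ`-mixing with respect to `P`. -/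
structure PhiMixing [MeasurableSpace Ω] (side : Side) (μ : Measure Ω) (T : Ω → Ω)
    (P : Set (Set Ω)) (φ : ℕ → ℝ) : Prop where
  antitone : Antitone φ
  tendsto : Tendsto φ atTop (𝓝 0)
  mixing : ∀ (n k : ℕ) (A B : Set Ω), MeasurableSet[sigmaCyl T P n] A →
    MeasurableSet[sigmaAll T P] B →
    |μ.real (A ∩ T^[n + k] ⁻¹' B) - μ.real A * μ.real B| ≤
      φ k * (match side with
        | .left => μ.real A
        | .right => μ.real B)

/-- `φ` decays at least polynomially with power `p`. -/
def PolyDecay (φ : ℕ → ℝ) (p : ℝ) : Prop :=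
  ∃ C : ℝ, ∀ k : ℕ, 1 ≤ k → φ k ≤ C * (k : ℝ) ^ (-p)

/-- The outer `j`-cylinder approximation of `V`. -/
def outerApprox (T : Ω → Ω) (P : Set (Set Ω)) (j : ℕ) (V : Set Ω) : Set Ω :=
  ⋃₀ {B | B ∈ cylJoin T P j ∧ (B ∩ V).Nonempty}

/-- For a set `V` measurable with respect to the `N`-cylinders and `j ≤ N`: the best outer
approximation `V^j` of `V` by `j`-cylinders, from the right in the left `φ`-mixing case and from
the left in the right `φ`-mixing case. -/
def sideApprox (side : Side) (T : Ω → Ω) (P : Set (Set Ω)) (N : ℕ) (V : Set Ω) (j : ℕ) : Set Ω :=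
  match side with
  | .left => outerApprox T P j (T^[N - j] '' V)
  | .right => outerApprox T P j V

/-- `⋂_{j=0}^{u} T^{-jm} V`. -/
def overlap (T : Ω → Ω) (m : ℕ) (V : Set Ω) (u : ℕ) : Set Ω :=
  ⋂ j ∈ Set.Iic u, T^[j * m] ⁻¹' V

/-- Decay of the measures of the `j`-cylinder approximations, with exponent `γ`. -/
def ApproxDecay [MeasurableSpace Ω] (side : Side) (μ : Measure Ω) (T : Ω → Ω)
    (P : Set (Set Ω)) (x : Ω) (U : ℕ → Set Ω) (γ : ℝ) : Prop :=
  ∃ K : ℝ, 0 < K ∧ K ≤ 1 ∧ ∃ C : ℝ,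
    (x ∉ Function.periodicPts T →
      ∀ n j : ℕ, 1 ≤ n → 1 ≤ j → (j : ℝ) ≤ K * n →
        μ.real (sideApprox side T P n (U n) j) ≤ C * (j : ℝ) ^ (-γ)) ∧
    (x ∈ Function.periodicPts T →
      ∀ n u j : ℕ, 1 ≤ n → 1 ≤ j →
        (j : ℝ) ≤ K * ((n : ℝ) + u * Function.minimalPeriod T x) →
        μ.real (sideApprox side T P (n + Function.minimalPeriod T x * u)
          (overlap T (Function.minimalPeriod T x) (U n) u) j) ≤ C * (j : ℝ) ^ (-γ))

/-- The structure of short returns at a periodic point with minimal period `m`: returns at times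
`0 = i₀ < ⋯ < i_k ≤ J n · n`, all multiples of `m`, have up to a factor `1 + o(1)` the same measure
as returns at all multiples of `m` up to `i_k`. -/
def PeriodicReturns [MeasurableSpace Ω] (μ : Measure Ω) (T : Ω → Ω) (m : ℕ) (U : ℕ → Set Ω)
    (J : ℕ → ℝ) : Prop :=
  (∀ n, 1 ≤ n → 0 < J n ∧ J n < 1) ∧
  Tendsto (fun n : ℕ => J n * n) atTop atTop ∧
  ∃ r : ℕ → ℝ, Tendsto r atTop (𝓝 0) ∧
    ∀ n : ℕ, 1 ≤ n → ∀ (k : ℕ) (i : Fin (k + 1) → ℕ), StrictMono i → i 0 = 0 →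
      (∀ j, m ∣ i j) → (i (Fin.last k) : ℝ) ≤ J n * n →
      |μ.real (⋂ j, T^[i j] ⁻¹' (U n)) - μ.real (overlap T m (U n) (i (Fin.last k) / m))| ≤
        r n * μ.real (overlap T m (U n) (i (Fin.last k) / m))

/-- `U 1, U 2, …` is an adapted neighbourhood system at `x`, with exponent `γ` and with the
cluster length function `J` (which matters only if `x` is periodic). The value `U 0` plays no
role. -/
structure IsAdapted [MeasurableSpace Ω] [TopologicalSpace Ω] (side : Side) (μ : Measure Ω)
    (T : Ω → Ω) (P : Set (Set Ω)) (x : Ω) (U : ℕ → Set Ω) (γ : ℝ) (J : ℕ → ℝ) : Prop where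
  measurable : ∀ n, 1 ≤ n → MeasurableSet[sigmaCyl T P n] (U n)
  nested : ∀ n, 1 ≤ n → U (n + 1) ⊆ U n
  iInter_eq : ⋂ n ∈ Set.Ici 1, U n = {x}
  -- together with the previous field: the nested sets `U n` contract to the point `x`
  contracts : ∀ V ∈ 𝓝 x, ∀ᶠ n in atTop, U n ⊆ V
  exponent_pos : 0 < γ
  decay : ApproxDecay side μ T P x U γ
  returns : x ∈ Function.periodicPts T →
    PeriodicReturns μ T (Function.minimalPeriod T x) U J

/-- The entry time `inf {j ≥ 1 : T^j y ∈ U}`, infinite if there is no such `j`. -/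
noncomputable def entryTime (T : Ω → Ω) (U : Set Ω) (y : Ω) : ℕ∞ :=
  ⨅ j ∈ {j : ℕ | 1 ≤ j ∧ T^[j] y ∈ U}, (j : ℕ∞)

/-- `(1/t) |log μ(τ_U > t)|`, with the value `+∞` if `μ(τ_U > t) = 0`. -/
noncomputable def escapeExponent [MeasurableSpace Ω] (μ : Measure Ω) (T : Ω → Ω) (U : Set Ω)
    (t : ℕ) : EReal :=
  (-ENNReal.log (μ {y | (t : ℕ∞) < entryTime T U y})) / (t : EReal)

/-- The escape rate to `U` exists and equals `ρ`. -/
def HasEscapeRate [MeasurableSpace Ω] (μ : Measure Ω) (T : Ω → Ω) (U : Set Ω) (ρ : EReal) : Prop :=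
  Tendsto (escapeExponent μ T U) atTop (𝓝 ρ)

/-- The lower escape rate to `U`. -/
noncomputable def lowerEscapeRate [MeasurableSpace Ω] (μ : Measure Ω) (T : Ω → Ω) (U : Set Ω) :
    EReal :=
  liminf (escapeExponent μ T U) atTop

/-- The upper escape rate to `U`. -/
noncomputable def upperEscapeRate [MeasurableSpace Ω] (μ : Measure Ω) (T : Ω → Ω) (U : Set Ω) :
    EReal :=
  limsup (escapeExponent μ T U) atTop

/-- The polynomial case. -/
def PolynomialCase [MeasurableSpace Ω] (μ : Measure Ω) (T : Ω → Ω) (x : Ω) (U : ℕ → Set Ω)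
    (γ : ℝ) (J : ℕ → ℝ) (p : ℝ) : Prop :=
  ∃ γ₂ ζ : ℝ, 1 < γ ∧ γ < γ₂ ∧ 0 < ζ ∧ ζ ≤ 1 ∧
    (∃ c : ℝ, 0 < c ∧ ∀ n : ℕ, 1 ≤ n → c * (n : ℝ) ^ (-γ₂) ≤ μ.real (U n)) ∧
    (∃ C : ℝ, ∀ n : ℕ, 1 ≤ n → μ.real (U n) ≤ C * (n : ℝ) ^ (-γ)) ∧
    (x ∈ Function.periodicPts T →
      ∃ c : ℝ, 0 < c ∧ ∀ n : ℕ, 1 ≤ n → c * (n : ℝ) ^ (-(1 - ζ)) ≤ J n) ∧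
    max 2 (2 * γ₂ / (ζ * γ) - 1) < p

/-- The exponential case. -/
def ExponentialCase [MeasurableSpace Ω] (μ : Measure Ω) (T : Ω → Ω) (x : Ω) (U : ℕ → Set Ω)
    (γ : ℝ) (J : ℕ → ℝ) (p : ℝ) : Prop :=
  ∃ ξ₁ ξ₂ J₀ : ℝ, 1 < γ ∧ 0 < ξ₁ ∧ ξ₁ < ξ₂ ∧ ξ₂ < 1 ∧ 0 < J₀ ∧ J₀ < 1 ∧
    (∃ c : ℝ, 0 < c ∧ ∀ n : ℕ, 1 ≤ n → c * ξ₁ ^ n ≤ μ.real (U n)) ∧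
    (∃ C : ℝ, ∀ n : ℕ, 1 ≤ n → μ.real (U n) ≤ C * ξ₂ ^ n) ∧
    (x ∈ Function.periodicPts T → ∀ n : ℕ, 1 ≤ n → J n = J₀) ∧
    8 / J₀ * (Real.log ξ₁ / Real.log ξ₂) - 1 < p

end EscapeRate

open EscapeRate

namespace EscapeRate

variable {Ω : Type*}

/-! Write `u = μ.real (U n)` and let `f t = μ.real (avoid T (U n) t)` be the survival probability.
Cut time into blocks of length `s ≈ ε/u` separated by gaps `n + Δ` with `Δ ≈ ε²/u`. Mixing across
the gaps makes the blocks almost independent, so `f` decays like the power `f s ^ k` over `k` blocks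
(`PhiMixing.avoid_le`, `PhiMixing.le_avoid`). Since `n * u → 0`, a gap takes up only a fraction of
order `ε` of a block, and `φ Δ → 0`.

It remains to see that one block loses mass `s * u * (1 - ϑ)` up to order `ε²`. By invariance, `1 -
f s` is a sum over `i < s` of the measures of points of `U n` that do not return during the next `i`
steps (`one_sub_measureReal_avoid`). Long returns cost at most a summable tail plus `s * u`
(`PhiMixing.exists_summable_return_bound`). For a fixed return time `l`, separation and continuity
at `x` exclude returns unless `T^[l] x = x`. At a periodic point the remaining returns almost all
pass through time `m`, the minimal period, and these form the proportion `ϑ`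
(`IsAdapted.exists_short_returns`).

`eventually_exp_bounds_of_recurrence` turns this into exponential bounds on `f` with rates `(1 - ϑ ±
η) * u`. The polynomial and the exponential case supply `1 < γ`, `1 < p`, `0 < u` and `n * u → 0`.
-/

/-- `y` and `z` lie in the same `n`-cylinder. -/
def SameCyl (T : Ω → Ω) (P : Set (Set Ω)) (n : ℕ) (y z : Ω) : Prop :=
  ∀ j < n, ∀ a ∈ P, T^[j] y ∈ a → T^[j] z ∈ a

/-! ### Cylinders as equivalence classes, and the σ-algebras they generate. -/

section Cylinders

variable {T : Ω → Ω} {P : Set (Set Ω)} {n k : ℕ} {A B V : Set Ω} {y z : Ω}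

theorem IsMeasPartition.exists_mem [MeasurableSpace Ω] (hP : IsMeasPartition P) (y : Ω) :
    ∃ a ∈ P, y ∈ a :=
  let ⟨a, ha, _⟩ := hP.isPartition.2 y
  ⟨a, ha.1, ha.2⟩

theorem IsMeasPartition.eq_of_mem [MeasurableSpace Ω] (hP : IsMeasPartition P) {a b : Set Ω}
    (ha : a ∈ P) (hb : b ∈ P) (hya : y ∈ a) (hyb : y ∈ b) : a = b :=
  (hP.isPartition.2 y).unique ⟨ha, hya⟩ ⟨hb, hyb⟩

/-- The cells cover: `T^[j] y` lies in some cell, which also contains `T^[j] z`; uniqueness of the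
cell makes the one-sided condition symmetric. -/
theorem SameCyl.symm [MeasurableSpace Ω] (hP : IsMeasPartition P) (h : SameCyl T P n y z) :
    SameCyl T P n z y := by
  intro j hj a ha hz
  obtain ⟨b, hb, hyb⟩ := hP.exists_mem (T^[j] y)
  rwa [hP.eq_of_mem ha hb hz (h j hj b hb hyb)]

theorem SameCyl.mono (h : SameCyl T P n y z) (hk : k ≤ n) : SameCyl T P k y z :=
  fun j hj => h j (hj.trans_le hk)

theorem SameCyl.iterate (h : SameCyl T P (n + k) y z) :
    SameCyl T P n (T^[k] y) (T^[k] z) := by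
  intro j hj a ha
  rw [← Function.iterate_add_apply, ← Function.iterate_add_apply]
  exact h (j + k) (by omega) a ha

theorem SameCyl.of_mem_cylJoin [MeasurableSpace Ω] (hP : IsMeasPartition P)
    (hB : B ∈ cylJoin T P n) (hy : y ∈ B) (hz : z ∈ B) : SameCyl T P n y z := by
  obtain ⟨-, a, ha, rfl⟩ := hB
  intro j hj b hb hyb
  rw [mem_iInter] at hy hz
  rw [hP.eq_of_mem hb (ha ⟨j, hj⟩) hyb (hy ⟨j, hj⟩)]
  exact hz ⟨j, hj⟩

theorem SameCyl.mem_of_mem_cylJoin (h : SameCyl T P n y z)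
    (hB : B ∈ cylJoin T P n) (hy : y ∈ B) : z ∈ B := by
  obtain ⟨-, a, ha, rfl⟩ := hB
  rw [mem_iInter] at hy ⊢
  exact fun j => h j j.2 _ (ha j) (hy j)

theorem exists_mem_cylJoin [MeasurableSpace Ω] (hP : IsMeasPartition P) (T : Ω → Ω) (n : ℕ)
    (y : Ω) : ∃ B ∈ cylJoin T P n, y ∈ B := by
  choose a ha hya using fun j : Fin n => hP.exists_mem (T^[(j : ℕ)] y)
  have hy : y ∈ ⋂ j : Fin n, T^[(j : ℕ)] ⁻¹' (a j) := mem_iInter.2 hya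
  exact ⟨_, ⟨⟨y, hy⟩, a, ha, rfl⟩, hy⟩

theorem countable_cylJoin [MeasurableSpace Ω] (hP : IsMeasPartition P) (T : Ω → Ω) (n : ℕ) :
    (cylJoin T P n).Countable := by
  have := hP.countable.to_subtype
  refine (countable_range fun a : Fin n → P => ⋂ j : Fin n, T^[(j : ℕ)] ⁻¹' (a j : Set Ω)).mono ?_
  rintro B ⟨-, a, ha, rfl⟩
  exact ⟨fun j => ⟨a j, ha j⟩, rfl⟩

/-- A set is measurable for the `n`-cylinders iff it is a union of `n`-cylinders. -/
theorem measurableSet_sigmaCyl_iff [MeasurableSpace Ω] (hP : IsMeasPartition P) :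
    MeasurableSet[sigmaCyl T P n] V ↔ ∀ y z, SameCyl T P n y z → y ∈ V → z ∈ V := by
  constructor
  · intro hV
    have key : ∀ y z, SameCyl T P n y z → (y ∈ V ↔ z ∈ V) := by
      refine MeasurableSpace.generateFrom_induction (cylJoin T P n)
        (fun V _ => ∀ y z, SameCyl T P n y z → (y ∈ V ↔ z ∈ V)) ?_ ?_ ?_ ?_ V hV
      · exact fun B hB _ y z h =>
          ⟨h.mem_of_mem_cylJoin hB, (h.symm hP).mem_of_mem_cylJoin hB⟩
      · simp
      · exact fun B _ ih y z h => not_congr (ih y z h)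
      · intro s _ ih y z h
        simp only [mem_iUnion]
        exact exists_congr fun i => ih i y z h
    exact fun y z h => (key y z h).1
  · intro h
    have hV : V = ⋃₀ {B | B ∈ cylJoin T P n ∧ B ⊆ V} := by
      ext y
      constructor
      · intro hy
        obtain ⟨B, hB, hyB⟩ := exists_mem_cylJoin hP T n y
        exact ⟨B, ⟨hB, fun z hz => h y z (.of_mem_cylJoin hP hB hyB hz) hy⟩, hyB⟩
      · rintro ⟨B, ⟨-, hBV⟩, hy⟩
        exact hBV hy
    rw [hV]
    exact MeasurableSet.sUnion ((countable_cylJoin hP T n).mono fun B hB => hB.1)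
      fun B hB => MeasurableSpace.measurableSet_generateFrom hB.1

theorem sigmaCyl_le [MeasurableSpace Ω] (hP : IsMeasPartition P) (hT : Measurable T) :
    sigmaCyl T P n ≤ ‹MeasurableSpace Ω› := by
  refine MeasurableSpace.generateFrom_le ?_
  rintro B ⟨-, a, ha, rfl⟩
  exact MeasurableSet.iInter fun j => hT.iterate j (hP.measurable _ (ha j))

theorem sigmaCyl_le_sigmaAll : sigmaCyl T P n ≤ sigmaAll T P :=
  MeasurableSpace.generateFrom_mono (subset_iUnion (cylJoin T P) n)

theorem measurableSet_outerApprox [MeasurableSpace Ω] (hP : IsMeasPartition P) (V : Set Ω) :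
    MeasurableSet[sigmaCyl T P n] (outerApprox T P n V) := by
  rw [measurableSet_sigmaCyl_iff hP]
  rintro y z h ⟨B, hB, hy⟩
  exact ⟨B, hB, h.mem_of_mem_cylJoin hB.1 hy⟩

theorem subset_outerApprox [MeasurableSpace Ω] (hP : IsMeasPartition P) (T : Ω → Ω) (n : ℕ)
    (V : Set Ω) : V ⊆ outerApprox T P n V := by
  intro y hy
  obtain ⟨B, hB, hyB⟩ := exists_mem_cylJoin hP T n y
  exact ⟨B, ⟨hB, y, hyB, hy⟩, hyB⟩

end Cylinders

/-! ### Survival probabilities. -/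

section Avoid

variable {T : Ω → Ω} {P : Set (Set Ω)} {U : Set Ω}

/-- The points whose first `t` iterates (starting with the zeroth) avoid `U`. -/
def avoid (T : Ω → Ω) (U : Set Ω) (t : ℕ) : Set Ω :=
  {y | ∀ j < t, T^[j] y ∉ U}

theorem avoid_anti {a b : ℕ} (h : a ≤ b) : avoid T U b ⊆ avoid T U a :=
  fun _ hy j hj => hy j (hj.trans_le h)

theorem mem_avoid_add {a b : ℕ} {y : Ω} :
    y ∈ avoid T U (a + b) ↔ y ∈ avoid T U a ∧ T^[a] y ∈ avoid T U b := by
  refine ⟨fun h => ⟨avoid_anti (Nat.le_add_right a b) h, fun j hj => ?_⟩, fun h j hj => ?_⟩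
  · rw [← Function.iterate_add_apply]
    exact h _ (by omega)
  · rcases lt_or_ge j a with hja | hja
    · exact h.1 j hja
    · have := h.2 (j - a) (by omega)
      rwa [← Function.iterate_add_apply, Nat.sub_add_cancel hja] at this

/-- The last time tested is `t - 1`, and deciding membership in `U` there takes `n` further symbols.
-/
theorem measurableSet_avoid [MeasurableSpace Ω] (hP : IsMeasPartition P) {n : ℕ}
    (hU : MeasurableSet[sigmaCyl T P n] U) (t : ℕ) :
    MeasurableSet[sigmaCyl T P (t + n)] (avoid T U t) := by
  rw [measurableSet_sigmaCyl_iff hP] at hU ⊢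
  intro y z h hy j hj hz
  have h' := (h.symm hP).mono (k := n + j) (by omega)
  exact hy j hj (hU _ _ h'.iterate hz)

variable [MeasurableSpace Ω] {μ : Measure Ω}

theorem measureReal_preimage_iterate (hT : MeasurePreserving T μ μ) {V : Set Ω}
    (hV : MeasurableSet V) (k : ℕ) : μ.real (T^[k] ⁻¹' V) = μ.real V := by
  rw [measureReal_def, (hT.iterate k).measure_preimage hV.nullMeasurableSet, measureReal_def]

theorem measurableSet_avoid' (hT : Measurable T) (hU : MeasurableSet U) (t : ℕ) :
    MeasurableSet (avoid T U t) := by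
  have : avoid T U t = ⋂ j ∈ Iio t, (T^[j] ⁻¹' U)ᶜ := by
    ext y; simp [avoid]
  rw [this]
  exact MeasurableSet.biInter (to_countable _) fun j _ => (hT.iterate j hU).compl

/-- The zeroth iterate is peeled off rather than the last, and invariance removes the shift. The
loss is then carried by points of `U`, which turns entries into returns. -/
theorem measureReal_avoid_succ [IsProbabilityMeasure μ] (hT : MeasurePreserving T μ μ)
    (hU : MeasurableSet U) (t : ℕ) :
    μ.real (avoid T U (t + 1)) =
      μ.real (avoid T U t) - μ.real (U ∩ T ⁻¹' (avoid T U t)) := by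
  have hF := measurableSet_avoid' hT.measurable hU t
  have h1 := measureReal_preimage_iterate hT hF 1
  have h2 : avoid T U (t + 1) = (T^[1] ⁻¹' avoid T U t) \ U := by
    ext y
    rw [add_comm, mem_avoid_add]
    simp [avoid, and_comm]
  have h3 := measureReal_inter_add_sdiff (μ := μ) (s := T^[1] ⁻¹' avoid T U t) hU
  rw [h2, ← h1, ← h3, inter_comm]
  simp

theorem measureReal_avoid_zero [IsProbabilityMeasure μ] : μ.real (avoid T U 0) = 1 := by
  simp [avoid]

theorem one_sub_measureReal_avoid [IsProbabilityMeasure μ] (hT : MeasurePreserving T μ μ)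
    (hU : MeasurableSet U) (t : ℕ) :
    1 - μ.real (avoid T U t) = ∑ i ∈ Finset.range t, μ.real (U ∩ T ⁻¹' (avoid T U i)) := by
  induction t with
  | zero => simp [measureReal_avoid_zero]
  | succ t ih => rw [Finset.sum_range_succ, ← ih, measureReal_avoid_succ hT hU]; ring

theorem one_sub_measureReal_avoid_le [IsProbabilityMeasure μ] (hT : MeasurePreserving T μ μ)
    (hU : MeasurableSet U)
    (t : ℕ) : 1 - μ.real (avoid T U t) ≤ t * μ.real U := by
  rw [one_sub_measureReal_avoid hT hU]
  calc _ ≤ ∑ i ∈ Finset.range t, μ.real U :=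
        Finset.sum_le_sum fun i _ => measureReal_mono inter_subset_left
    _ = _ := by simp

end Avoid

/-! ### Block recurrences for the survival probability. -/

section Mixing

variable [MeasurableSpace Ω] {μ : Measure Ω} {T : Ω → Ω}
  {P : Set (Set Ω)} {φ : ℕ → ℝ} {side : Side} {U : Set Ω} {n : ℕ}

theorem PhiMixing.nonneg (h : PhiMixing side μ T P φ) (k : ℕ) : 0 ≤ φ k :=
  h.antitone.le_of_tendsto h.tendsto k

theorem PhiMixing.abs_le_left (h : PhiMixing .left μ T P φ) {a b t k : ℕ} {A B : Set Ω}
    (hA : MeasurableSet[sigmaCyl T P a] A) (hB : MeasurableSet[sigmaCyl T P b] B)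
    (ht : a + k ≤ t) : |μ.real (A ∩ T^[t] ⁻¹' B) - μ.real A * μ.real B| ≤ φ k * μ.real A := by
  obtain ⟨d, rfl⟩ := Nat.exists_eq_add_of_le ht
  refine (add_assoc a k d ▸ h.mixing a (k + d) A B hA (sigmaCyl_le_sigmaAll _ hB)).trans ?_
  exact mul_le_mul_of_nonneg_right (h.antitone (Nat.le_add_right k d)) measureReal_nonneg

theorem PhiMixing.abs_le_right (h : PhiMixing .right μ T P φ) {a b t k : ℕ} {A B : Set Ω}
    (hA : MeasurableSet[sigmaCyl T P a] A) (hB : MeasurableSet[sigmaCyl T P b] B)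
    (ht : a + k ≤ t) : |μ.real (A ∩ T^[t] ⁻¹' B) - μ.real A * μ.real B| ≤ φ k * μ.real B := by
  obtain ⟨d, rfl⟩ := Nat.exists_eq_add_of_le ht
  refine (add_assoc a k d ▸ h.mixing a (k + d) A B hA (sigmaCyl_le_sigmaAll _ hB)).trans ?_
  exact mul_le_mul_of_nonneg_right (h.antitone (Nat.le_add_right k d)) measureReal_nonneg

/-- Forget what happens in a gap of length `n + Δ`; the `n` pays for the symbols by which the
earlier block overshoots. The mixing error carries the measure of the first set in the left case and
of the second in the right case, so the blocks are placed in opposite orders, and the error is a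
multiple of `μ.real (avoid T U t)` both times. -/
theorem PhiMixing.avoid_le [IsProbabilityMeasure μ] (h : PhiMixing side μ T P φ)
    (hP : IsMeasPartition P)
    (hU : MeasurableSet[sigmaCyl T P n] U) (t s Δ : ℕ) :
    μ.real (avoid T U (t + (n + Δ + s))) ≤
      μ.real (avoid T U t) * (μ.real (avoid T U s) + φ Δ) := by
  have hs := measurableSet_avoid hP hU s
  have ht := measurableSet_avoid hP hU t
  cases side with
  | left =>
    have h1 := (abs_le.1 (h.abs_le_left (t := t + n + Δ) (k := Δ) ht hs le_rfl)).2
    have h2 : μ.real (avoid T U (t + (n + Δ + s))) ≤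
        μ.real (avoid T U t ∩ T^[t + n + Δ] ⁻¹' avoid T U s) := by
      refine measureReal_mono fun y hy => ?_
      rw [show t + (n + Δ + s) = t + n + Δ + s by ring, mem_avoid_add] at hy
      exact ⟨avoid_anti (by omega) hy.1, hy.2⟩
    linarith
  | right =>
    have h1 := (abs_le.1 (h.abs_le_right (t := s + n + Δ) (k := Δ) hs ht le_rfl)).2
    have h2 : μ.real (avoid T U (t + (n + Δ + s))) ≤
        μ.real (avoid T U s ∩ T^[s + n + Δ] ⁻¹' avoid T U t) := by
      refine measureReal_mono fun y hy => ?_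
      rw [show t + (n + Δ + s) = s + n + Δ + t by ring, mem_avoid_add] at hy
      exact ⟨avoid_anti (by omega) hy.1, hy.2⟩
    linarith

/-- Here the gap must also be survived. The cost is an entry during the gap, which has to be small
relative to survival. To decouple the two, survival up to `t + (n + Δ + s)` is weakened to survival
up to `t`, leaving room for mixing; hence a recurrence over two blocks. The right case is the same
picture with time reversed. -/
theorem PhiMixing.le_avoid [IsProbabilityMeasure μ] (h : PhiMixing side μ T P φ)
    (hP : IsMeasPartition P)
    (hT : MeasurePreserving T μ μ) (hU : MeasurableSet[sigmaCyl T P n] U) (t s Δ : ℕ) :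
    μ.real (avoid T U (t + (n + Δ + s))) * (μ.real (avoid T U s) - φ Δ) -
        μ.real (avoid T U t) * ((n + Δ : ℕ) * μ.real U + φ Δ) ≤
      μ.real (avoid T U (t + (n + Δ + s) + (n + Δ + s))) := by
  have hU' : MeasurableSet U := sigmaCyl_le hP hT.measurable _ hU
  set g := n + Δ with hg
  have hs := measurableSet_avoid hP hU s
  have ht := measurableSet_avoid hP hU t
  have htL := measurableSet_avoid hP hU (t + (g + s))
  have hH : MeasurableSet[sigmaCyl T P (g + n)] (avoid T U g)ᶜ :=
    MeasurableSet.compl (measurableSet_avoid hP hU g)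
  have hHμ : μ.real (avoid T U g)ᶜ ≤ g * μ.real U := by
    rw [probReal_compl_eq_one_sub (measurableSet_avoid' hT.measurable hU' g)]
    exact one_sub_measureReal_avoid_le hT hU' g
  have hft : 0 ≤ μ.real (avoid T U t) := measureReal_nonneg
  have hmul := mul_le_mul_of_nonneg_left hHμ hft
  cases side with
  | left =>
    have h1 := (abs_le.1 (h.abs_le_left (t := t + (g + s) + g) (k := Δ) htL hs (by omega))).1
    have h2 := (abs_le.1 (h.abs_le_left (t := t + (g + s)) (k := Δ) ht hH (by omega))).2
    have h3 : avoid T U (t + (g + s)) ∩ T^[t + (g + s) + g] ⁻¹' avoid T U s ⊆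
        avoid T U (t + (g + s) + (g + s)) ∪
          (avoid T U t ∩ T^[t + (g + s)] ⁻¹' (avoid T U g)ᶜ) := by
      rintro y ⟨hy, hy'⟩
      by_cases hyg : T^[t + (g + s)] y ∈ avoid T U g
      · left
        rw [← add_assoc (t + (g + s)) g s, mem_avoid_add, mem_avoid_add]
        exact ⟨⟨hy, hyg⟩, hy'⟩
      · exact Or.inr ⟨avoid_anti (by omega) hy, hyg⟩
    have h4 := (measureReal_mono (μ := μ) h3).trans (measureReal_union_le _ _)
    linarith
  | right =>
    have h1 := (abs_le.1 (h.abs_le_right (t := s + g) (k := Δ) hs htL (by omega))).1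
    have h2 := (abs_le.1 (h.abs_le_right (t := g + (g + s)) (k := Δ) hH ht (by omega))).2
    have h3 : avoid T U s ∩ T^[s + g] ⁻¹' avoid T U (t + (g + s)) ⊆
        avoid T U (t + (g + s) + (g + s)) ∪
          T^[s] ⁻¹' ((avoid T U g)ᶜ ∩ T^[g + (g + s)] ⁻¹' avoid T U t) := by
      rintro y ⟨hy, hy'⟩
      by_cases hyg : T^[s] y ∈ avoid T U g
      · left
        rw [show t + (g + s) + (g + s) = s + g + (t + (g + s)) by ring, mem_avoid_add,
          mem_avoid_add]
        exact ⟨⟨hy, hyg⟩, hy'⟩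
      · right
        refine ⟨hyg, ?_⟩
        rw [mem_preimage, show t + (g + s) = (g + s) + t by ring, mem_avoid_add] at hy'
        rw [mem_preimage, ← Function.iterate_add_apply,
          show g + (g + s) + s = (g + s) + (s + g) by ring, Function.iterate_add_apply]
        exact hy'.2
    have h4 := (measureReal_mono (μ := μ) h3).trans (measureReal_union_le _ _)
    rw [measureReal_preimage_iterate hT] at h4
    · linarith
    · exact (sigmaCyl_le hP hT.measurable _ hH).inter
        (hT.measurable.iterate _ (measurableSet_avoid' hT.measurable hU' t))

end Mixing

/-! ### Return probabilities and the loss in a single block. -/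

section Returns

variable [MeasurableSpace Ω] {μ : Measure Ω} {T : Ω → Ω}
  {P : Set (Set Ω)} {φ : ℕ → ℝ} {side : Side} {n : ℕ}

theorem PhiMixing.measureReal_inter_preimage_le [IsProbabilityMeasure μ]
    (h : PhiMixing side μ T P φ) {V : Set Ω}
    (hV : MeasurableSet[sigmaCyl T P n] V) {l : ℕ} (hl : n ≤ l) :
    μ.real (V ∩ T^[l] ⁻¹' V) ≤ μ.real V * (μ.real V + φ (l - n)) := by
  cases side with
  | left =>
    have := (abs_le.1 (h.abs_le_left (t := l) (k := l - n) hV hV (by omega))).2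
    linarith
  | right =>
    have := (abs_le.1 (h.abs_le_right (t := l) (k := l - n) hV hV (by omega))).2
    linarith

/-- For `l < n` the two copies of `V` share symbols. One is coarsened to `j` symbols, the last ones
of the later copy (left) or the first ones of the earlier copy (right), which opens a gap `l - j`.
The intact copy is the one whose measure multiplies `φ`. -/
theorem PhiMixing.measureReal_inter_preimage_le_sideApprox [IsProbabilityMeasure μ]
    (h : PhiMixing side μ T P φ) (hP : IsMeasPartition P) {V : Set Ω}
    (hV : MeasurableSet[sigmaCyl T P n] V) {l j : ℕ} (hjn : j ≤ n) (hjl : j ≤ l) :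
    μ.real (V ∩ T^[l] ⁻¹' V) ≤ μ.real V * (μ.real (sideApprox side T P n V j) + φ (l - j)) := by
  cases side with
  | left =>
    have hW := measurableSet_outerApprox (T := T) (n := j) hP (T^[n - j] '' V)
    have h1 := (abs_le.1 (h.abs_le_left (t := n - j + l) (k := l - j) hV hW (by omega))).2
    have h2 : V ∩ T^[l] ⁻¹' V ⊆
        V ∩ T^[n - j + l] ⁻¹' outerApprox T P j (T^[n - j] '' V) := by
      rintro y ⟨hy, hy'⟩
      refine ⟨hy, subset_outerApprox hP T j _ ?_⟩
      rw [Function.iterate_add_apply]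
      exact mem_image_of_mem _ hy'
    have h3 := measureReal_mono (μ := μ) h2
    simp only [sideApprox]
    linarith
  | right =>
    have hW := measurableSet_outerApprox (T := T) (n := j) hP V
    have h1 := (abs_le.1 (h.abs_le_right (t := l) (k := l - j) hW hV (by omega))).2
    have h2 : V ∩ T^[l] ⁻¹' V ⊆ outerApprox T P j V ∩ T^[l] ⁻¹' V :=
      inter_subset_inter_left _ (subset_outerApprox hP T j V)
    have h3 := measureReal_mono (μ := μ) h2
    simp only [sideApprox]
    linarith

/-- Returns after a long time are, up to a summable error, independent of the start. -/
theorem PhiMixing.exists_summable_return_bound [IsProbabilityMeasure μ]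
    (h : PhiMixing side μ T P φ) (hP : IsMeasPartition P) {p γ K C : ℝ} (hφ : PolyDecay φ p)
    (hp : 1 < p) (hγ : 1 < γ) (hK : 0 < K) (hK1 : K ≤ 1) {U : ℕ → Set Ω}
    (hU : ∀ n, 1 ≤ n → MeasurableSet[sigmaCyl T P n] (U n))
    (hdecay : ∀ n j : ℕ, 1 ≤ n → 1 ≤ j → (j : ℝ) ≤ K * n →
      μ.real (sideApprox side T P n (U n) j) ≤ C * (j : ℝ) ^ (-γ)) :
    ∃ b : ℕ → ℝ, Summable b ∧ ∃ M : ℕ, ∀ l ≥ M, ∀ n ≥ 1,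
      μ.real (U n ∩ T^[l] ⁻¹' U n) ≤ μ.real (U n) * (μ.real (U n) + b l) := by
  obtain ⟨C', hC'⟩ := hφ
  -- With `j = ⌊K * l / 2⌋₊`, the bound `l ≥ 2 / K` gives `j ≥ K / 4 * l`, while `l / 2` bounds from
  -- below the gaps `l - j` and `l - n` used in the two regimes.
  refine ⟨fun l => |C| * (K / 4 * l) ^ (-γ) + |C'| * (1 / 2 * l) ^ (-p), ?_, ⌈2 / K⌉₊, ?_⟩
  · have hs : ∀ a q : ℝ, 0 ≤ a → 1 < q → Summable fun l : ℕ => (a * (l : ℝ)) ^ (-q) := by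
      intro a q ha hq
      simp_rw [fun l : ℕ => Real.mul_rpow (z := -q) ha (Nat.cast_nonneg l)]
      exact (Real.summable_nat_rpow.2 (by linarith)).mul_left _
    exact ((hs _ _ (by positivity) hγ).mul_left _).add ((hs _ _ (by positivity) hp).mul_left _)
  intro l hl n hn
  have hlK : 2 / K ≤ l := Nat.ceil_le.1 hl
  have hKl : 1 ≤ K * l / 2 := by
    rw [div_le_iff₀ hK] at hlK
    linarith
  have hl0 : (0 : ℝ) < l := by nlinarith
  have hφ' : ∀ k : ℕ, (1 / 2 * l : ℝ) ≤ k → φ k ≤ |C'| * (1 / 2 * l : ℝ) ^ (-p) := by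
    intro k hk
    have hk0 : (0 : ℝ) < k := by linarith
    calc φ k ≤ C' * (k : ℝ) ^ (-p) := hC' k (Nat.cast_pos.1 hk0)
      _ ≤ |C'| * (k : ℝ) ^ (-p) := by gcongr; exact le_abs_self _
      _ ≤ _ := by
        gcongr 1
        exact Real.rpow_le_rpow_of_nonpos (by linarith) hk (by linarith)
  have hb : 0 ≤ |C| * (K / 4 * l) ^ (-γ) := by positivity
  -- For `l ≤ 2 * n` one has `j ≤ K * n`, so the approximation bound applies; beyond, plain mixing
  -- has gap at least `l / 2`.
  rcases le_or_gt l (2 * n) with hln | hln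
  · set j := ⌊K * l / 2⌋₊ with hj
    have hj1 : 1 ≤ j := Nat.le_floor (by simpa using hKl)
    have hjle : (j : ℝ) ≤ K * l / 2 := Nat.floor_le (by linarith)
    have hjge : K / 4 * l ≤ j := by
      have h1 : K * l / 2 < j + 1 := Nat.lt_floor_add_one _
      have h2 : (1 : ℝ) ≤ j := by exact_mod_cast hj1
      linarith
    have hln' : (l : ℝ) ≤ 2 * n := by exact_mod_cast hln
    have hjl2 : (j : ℝ) ≤ l / 2 := by nlinarith
    have hjKn : (j : ℝ) ≤ K * n := by nlinarith
    have hjn : j ≤ n := by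
      have : (j : ℝ) ≤ n := by linarith
      exact_mod_cast this
    have hjl : j ≤ l := by
      have : (j : ℝ) ≤ l := by linarith
      exact_mod_cast this
    refine (h.measureReal_inter_preimage_le_sideApprox hP (hU n hn) hjn hjl).trans ?_
    have h1 : μ.real (sideApprox side T P n (U n) j) ≤ |C| * (K / 4 * l) ^ (-γ) :=
      calc _ ≤ C * (j : ℝ) ^ (-γ) := hdecay n j hn hj1 hjKn
        _ ≤ |C| * (j : ℝ) ^ (-γ) := by gcongr; exact le_abs_self _
        _ ≤ _ := by
          gcongr 1
          exact Real.rpow_le_rpow_of_nonpos (by positivity) hjge (by linarith)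
    have h2 := hφ' (l - j) (by rw [Nat.cast_sub hjl]; linarith)
    have h3 : 0 ≤ μ.real (U n) := measureReal_nonneg
    exact mul_le_mul_of_nonneg_left (by linarith) h3
  · have hln' : (2 * n : ℝ) < l := by exact_mod_cast hln
    have hnl : n ≤ l := by omega
    refine (h.measureReal_inter_preimage_le (hU n hn) hnl).trans ?_
    have h2 := hφ' (l - n) (by rw [Nat.cast_sub hnl]; linarith)
    exact mul_le_mul_of_nonneg_left (by linarith) measureReal_nonneg

/-- Summability of `b` fixes a cutoff `N` depending only on `δ`; the finitely many return times
below it are negligible one by one as `n → ∞`. -/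
theorem sum_measureReal_returns_le [IsFiniteMeasure μ] {U D : ℕ → Set Ω} {b : ℕ → ℝ} {M : ℕ}
    (hb : Summable b)
    (hbound : ∀ l ≥ M, ∀ n ≥ 1,
      μ.real (U n ∩ T^[l] ⁻¹' U n) ≤ μ.real (U n) * (μ.real (U n) + b l))
    (hpos : ∀ n, 1 ≤ n → 0 < μ.real (U n))
    (hshort : ∀ l, 1 ≤ l →
      Tendsto (fun n => μ.real ((U n ∩ T^[l] ⁻¹' U n) \ D n) / μ.real (U n)) atTop (𝓝 0))
    {δ : ℝ} (hδ : 0 < δ) :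
    ∀ᶠ n in atTop, ∀ s : ℕ, ∑ l ∈ Finset.Icc 1 s, μ.real ((U n ∩ T^[l] ⁻¹' U n) \ D n) ≤
      μ.real (U n) * (δ + s * μ.real (U n)) := by
  obtain ⟨S, hS⟩ := summable_iff_vanishing_norm.1 hb (δ / 2) (by positivity)
  set N := max M (S.sup id + 1) with hN
  have hfin : Tendsto (fun n => ∑ l ∈ Finset.Ico 1 N,
      μ.real ((U n ∩ T^[l] ⁻¹' U n) \ D n) / μ.real (U n)) atTop (𝓝 0) := by
    simpa using tendsto_finsetSum (Finset.Ico 1 N)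
      fun l hl => hshort l (Finset.mem_Ico.1 hl).1
  filter_upwards [hfin.eventually_le_const (show (0 : ℝ) < δ / 2 by positivity),
    eventually_ge_atTop 1] with n hn hn1 s
  have hu := hpos n hn1
  rw [← Finset.sum_div, div_le_iff₀ hu] at hn
  rw [← Finset.sum_filter_add_sum_filter_not _ (· < N)]
  have h1 : ∑ l ∈ Finset.Icc 1 s with l < N, μ.real ((U n ∩ T^[l] ⁻¹' U n) \ D n) ≤
      ∑ l ∈ Finset.Ico 1 N, μ.real ((U n ∩ T^[l] ⁻¹' U n) \ D n) := by
    refine Finset.sum_le_sum_of_subset_of_nonneg (fun l hl => ?_) fun _ _ _ => measureReal_nonneg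
    simp only [Finset.mem_filter, Finset.mem_Icc, Finset.mem_Ico] at hl ⊢
    exact ⟨hl.1.1, hl.2⟩
  set R := {l ∈ Finset.Icc 1 s | ¬ l < N} with hR
  have h2 : ∑ l ∈ R, μ.real ((U n ∩ T^[l] ⁻¹' U n) \ D n) ≤
      ∑ l ∈ R, μ.real (U n) * (μ.real (U n) + b l) := by
    refine Finset.sum_le_sum fun l hl => ?_
    have hlN : N ≤ l := not_lt.1 (Finset.mem_filter.1 hl).2
    exact (measureReal_mono sdiff_subset).trans (hbound l ((le_max_left _ _).trans hlN) n hn1)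
  have h3 : ∑ l ∈ R, b l < δ / 2 := by
    refine (le_abs_self _).trans_lt (hS R (Finset.disjoint_left.2 fun l hl hlS => ?_))
    have hlN : N ≤ l := not_lt.1 (Finset.mem_filter.1 hl).2
    have h4 : l ≤ S.sup id := Finset.le_sup (f := id) hlS
    have h5 : S.sup id + 1 ≤ l := (le_max_right _ _).trans hlN
    omega
  have h4 : (R.card : ℝ) ≤ s := by
    have : R.card ≤ (Finset.Icc 1 s).card := Finset.card_filter_le _ _
    simp only [Nat.card_Icc, Nat.add_sub_cancel] at this
    exact_mod_cast this
  rw [← Finset.mul_sum, Finset.sum_add_distrib, Finset.sum_const, nsmul_eq_mul] at h2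
  have h5 : (R.card : ℝ) * μ.real (U n) + ∑ l ∈ R, b l ≤ s * μ.real (U n) + δ / 2 := by
    gcongr
  have h6 := mul_le_mul_of_nonneg_left h5 hu.le
  linarith

/-- A point of `V` that comes back within `i` steps either lies in `D` or makes one of the listed
returns outside `D`. This bounds each of the `s` terms of `one_sub_measureReal_avoid` from below. -/
theorem le_one_sub_measureReal_avoid [IsProbabilityMeasure μ] (hT : MeasurePreserving T μ μ)
    {V : Set Ω} (hV : MeasurableSet V) (D : Set Ω) (s : ℕ) :
    s * (μ.real V - μ.real (V ∩ D) -
      ∑ l ∈ Finset.Icc 1 s, μ.real ((V ∩ T^[l] ⁻¹' V) \ D)) ≤ 1 - μ.real (avoid T V s) := by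
  rw [one_sub_measureReal_avoid hT hV, ← nsmul_eq_mul]
  conv_lhs => rw [← Finset.card_range s]
  refine Finset.card_nsmul_le_sum _ _ _ fun i hi => ?_
  have hi := Finset.mem_range.1 hi
  have h1 : V ⊆ (V ∩ T ⁻¹' avoid T V i) ∪
      ((V ∩ D) ∪ ⋃ l ∈ Finset.Icc 1 s, (V ∩ T^[l] ⁻¹' V) \ D) := by
    intro y hy
    by_cases hyD : y ∈ D
    · exact Or.inr (Or.inl ⟨hy, hyD⟩)
    by_cases hya : T y ∈ avoid T V i
    · exact Or.inl ⟨hy, hya⟩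
    · right; right
      simp only [avoid, mem_ofPred_eq, not_forall, not_not] at hya
      obtain ⟨j, hj, hjV⟩ := hya
      simp only [mem_iUnion]
      exact ⟨j + 1, Finset.mem_Icc.2 ⟨by omega, by omega⟩, ⟨hy, hjV⟩, hyD⟩
  have h2 := (measureReal_mono (μ := μ) h1).trans (measureReal_union_le _ _)
  have h3 := measureReal_union_le (μ := μ) (V ∩ D)
    (⋃ l ∈ Finset.Icc 1 s, (V ∩ T^[l] ⁻¹' V) \ D)
  have h4 := measureReal_biUnion_finset_le (μ := μ) (Finset.Icc 1 s)
    fun l => (V ∩ T^[l] ⁻¹' V) \ D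
  rw [Finset.card_range]
  linarith

/-- Points of `V ∩ D` come back within `m` steps, so they contribute only to the first `m` terms of
`one_sub_measureReal_avoid`. -/
theorem one_sub_measureReal_avoid_le_of_disjoint [IsProbabilityMeasure μ]
    (hT : MeasurePreserving T μ μ) {V : Set Ω} (hV : MeasurableSet V) {D : Set Ω}
    (hD : MeasurableSet D) {m : ℕ} (hdisj : Disjoint (V ∩ D) (T ⁻¹' avoid T V m)) (s : ℕ) :
    1 - μ.real (avoid T V s) ≤ m * μ.real V + s * (μ.real V - μ.real (V ∩ D)) := by
  have hVD : 0 ≤ μ.real V - μ.real (V ∩ D) := sub_nonneg.2 (measureReal_mono inter_subset_left)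
  have hstep : ∀ i, μ.real (V ∩ T ⁻¹' avoid T V i) ≤
      (if i < m then μ.real V else 0) + (μ.real V - μ.real (V ∩ D)) := by
    intro i
    split_ifs with him
    · linarith [measureReal_mono (μ := μ) (inter_subset_left : V ∩ T ⁻¹' avoid T V i ⊆ V)]
    · have h1 : V ∩ T ⁻¹' avoid T V i ⊆ V \ D := fun y hy =>
        ⟨hy.1, fun hyD => disjoint_left.1 hdisj ⟨hy.1, hyD⟩ (avoid_anti (not_lt.1 him) hy.2)⟩
      have h2 := measureReal_mono (μ := μ) h1
      have h3 := measureReal_inter_add_sdiff (μ := μ) (s := V) hD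
      linarith
  rw [one_sub_measureReal_avoid hT hV]
  refine (Finset.sum_le_sum fun i _ => hstep i).trans ?_
  rw [Finset.sum_add_distrib, Finset.sum_const, Finset.card_range, nsmul_eq_mul,
    ← Finset.sum_filter, Finset.sum_const, nsmul_eq_mul]
  have : ({i ∈ Finset.range s | i < m}).card ≤ m := by
    refine (Finset.card_le_card fun i hi => ?_).trans_eq (Finset.card_range m)
    exact Finset.mem_range.2 (Finset.mem_filter.1 hi).2
  gcongr

end Returns

/-! ### Short returns near `x`. -/

theorem overlap_subset (T : Ω → Ω) (m : ℕ) (V : Set Ω) (u : ℕ) : overlap T m V u ⊆ V := by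
  intro y hy
  simpa using mem_iInter₂.1 hy 0 (mem_Iic.2 (Nat.zero_le u))

/-- The return patterns `0, l` and `0, m, l` are both within a relative error `r n` of the same
overlap set, so a return at `l` that skips `m` has measure at most `2 * |r n| * μ.real (U n)`. Since
`J n * n → ∞`, a fixed `l` is eventually admissible. -/
theorem PeriodicReturns.tendsto_short_returns [MeasurableSpace Ω] {μ : Measure Ω}
    [IsFiniteMeasure μ]
    {T : Ω → Ω} {U : ℕ → Set Ω} {J : ℕ → ℝ} {m : ℕ} (hT : Measurable T)
    (h : PeriodicReturns μ T m U J) (hU : ∀ n, 1 ≤ n → MeasurableSet (U n))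
    (hpos : ∀ n, 1 ≤ n → 0 < μ.real (U n)) (hm : 0 < m) {l : ℕ} (hml : m ∣ l) (hlt : m < l) :
    Tendsto (fun n => μ.real ((U n ∩ T^[l] ⁻¹' U n) \ T^[m] ⁻¹' U n) / μ.real (U n))
      atTop (𝓝 0) := by
  obtain ⟨-, hJ, r, hr, hret⟩ := h
  have hr' : Tendsto (fun n => 2 * |r n|) atTop (𝓝 0) := by
    simpa using hr.abs.const_mul 2
  refine tendsto_of_tendsto_of_tendsto_of_le_of_le' tendsto_const_nhds hr'
    (Eventually.of_forall fun n => by positivity) ?_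
  filter_upwards [eventually_ge_atTop 1, hJ.eventually_ge_atTop (l : ℝ)] with n hn hl
  rw [div_le_iff₀ (hpos n hn)]
  have h1 := hret n hn 1 ![0, l] (by
    refine Fin.strictMono_iff_lt_succ.2 fun i => ?_
    fin_cases i
    simpa using hm.trans hlt) rfl (by simpa [Fin.forall_fin_two] using hml) (by simpa using hl)
  have h2 := hret n hn 2 ![0, m, l] (by
    refine Fin.strictMono_iff_lt_succ.2 fun i => ?_
    fin_cases i
    · simpa using hm
    · simpa using hlt) rfl (by simpa [Fin.forall_fin_succ] using hml)
    (by simpa [Fin.last] using hl)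
  have e1 : ⋂ j, T^[(![0, l] : Fin 2 → ℕ) j] ⁻¹' U n = U n ∩ T^[l] ⁻¹' U n := by
    ext y; simp [Fin.forall_fin_two]
  have e2 : ⋂ j, T^[(![0, m, l] : Fin 3 → ℕ) j] ⁻¹' U n =
      (U n ∩ T^[l] ⁻¹' U n) ∩ T^[m] ⁻¹' U n := by
    ext y; simp [Fin.forall_fin_succ]; tauto
  have l1 : (![0, l] : Fin 2 → ℕ) (Fin.last 1) = l := rfl
  have l2 : (![0, m, l] : Fin 3 → ℕ) (Fin.last 2) = l := rfl
  rw [e1, l1] at h1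
  rw [e2, l2] at h2
  have hO := measureReal_mono (μ := μ) (overlap_subset T m (U n) (l / m))
  have hO0 : 0 ≤ μ.real (overlap T m (U n) (l / m)) := measureReal_nonneg
  have h3 := measureReal_inter_add_sdiff (μ := μ) (s := U n ∩ T^[l] ⁻¹' U n)
    (hT.iterate m (hU n hn))
  have h4 : r n * μ.real (overlap T m (U n) (l / m)) ≤ |r n| * μ.real (U n) :=
    mul_le_mul (le_abs_self _) hO hO0 (abs_nonneg _)
  linarith [(abs_le.1 h1).2, (abs_le.1 h2).1]

section ShortReturns

variable [MeasurableSpace Ω] [TopologicalSpace Ω] {μ : Measure Ω} {T : Ω → Ω}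
  {P : Set (Set Ω)} {side : Side} {x : Ω} {U : ℕ → Set Ω} {γ : ℝ} {J : ℕ → ℝ}

/-- Disjoint neighbourhoods separate `T^[l] x` from `x`; by continuity and contraction, for large
`n` the set `U n` lies in one and its image under `T^[l]` in the other. -/
theorem IsAdapted.eventually_inter_preimage_eq_empty [T2Space Ω]
    (hU : IsAdapted side μ T P x U γ J) {l : ℕ} (hcont : ContinuousAt (T^[l]) x)
    (hl : T^[l] x ≠ x) : ∀ᶠ n in atTop, U n ∩ T^[l] ⁻¹' U n = ∅ := by
  obtain ⟨V, W, hV, hW, hVW⟩ := t2_separation_nhds hl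
  filter_upwards [hU.contracts _ (inter_mem (hcont.preimage_mem_nhds hV) hW)] with n hn
  refine eq_empty_of_forall_notMem fun y hy => ?_
  exact disjoint_left.1 hVW (hn hy.1).1 (hn hy.2).2

/-- The part `D n` of the space that is responsible for the short returns to `U n`. -/
theorem IsAdapted.exists_short_returns [T2Space Ω] [IsFiniteMeasure μ] (hT : Measurable T)
    (hU : IsAdapted side μ T P x U γ J) (hUm : ∀ n, 1 ≤ n → MeasurableSet (U n))
    (hpos : ∀ n, 1 ≤ n → 0 < μ.real (U n)) (hcont : ∀ k : ℕ, ContinuousAt (T^[k]) x) {ϑ : ℝ}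
    (hnonper : x ∉ Function.periodicPts T → ϑ = 0)
    (hper : x ∈ Function.periodicPts T →
      Tendsto (fun n => μ.real (U n ∩ T^[Function.minimalPeriod T x] ⁻¹' (U n)) / μ.real (U n))
        atTop (𝓝 ϑ)) :
    ∃ (D : ℕ → Set Ω) (m : ℕ), (∀ n, 1 ≤ n → MeasurableSet (D n)) ∧
      (∀ n, Disjoint (U n ∩ D n) (T ⁻¹' avoid T (U n) m)) ∧
      Tendsto (fun n => μ.real (U n ∩ D n) / μ.real (U n)) atTop (𝓝 ϑ) ∧
      ∀ l, 1 ≤ l →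
        Tendsto (fun n => μ.real ((U n ∩ T^[l] ⁻¹' U n) \ D n) / μ.real (U n)) atTop (𝓝 0) := by
  have hne : ∀ (l : ℕ) (D : ℕ → Set Ω), T^[l] x ≠ x →
      Tendsto (fun n => μ.real ((U n ∩ T^[l] ⁻¹' U n) \ D n) / μ.real (U n)) atTop (𝓝 0) := by
    intro l D hl
    refine tendsto_const_nhds.congr' ?_
    filter_upwards [hU.eventually_inter_preimage_eq_empty (hcont l) hl] with n hn
    simp [hn]
  by_cases hx : x ∈ Function.periodicPts T
  · set m := Function.minimalPeriod T x with hm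
    have hm0 : 0 < m := Function.minimalPeriod_pos_of_mem_periodicPts hx
    -- At a periodic point the short returns are those that take place at time `m`; after one
    -- application of `T` this is iterate `m - 1`.
    refine ⟨fun n => T^[m] ⁻¹' U n, m, fun n hn => hT.iterate m (hUm n hn), fun n => ?_,
      hper hx, fun l hl => ?_⟩
    · refine disjoint_left.2 fun y hy hy' => hy' (m - 1) (by omega) ?_
      rw [← Function.iterate_succ_apply, Nat.succ_eq_add_one, Nat.sub_add_cancel hm0]
      exact hy.2
    · by_cases hlx : T^[l] x = x
      · have hml : m ∣ l := Function.IsPeriodicPt.minimalPeriod_dvd hlx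
        rcases (Nat.le_of_dvd hl hml).eq_or_lt with rfl | hlt
        · refine tendsto_const_nhds.congr fun n => ?_
          rw [sdiff_eq_empty.2 inter_subset_right]
          simp
        · exact (hU.returns hx).tendsto_short_returns hT hUm hpos hm0 hml hlt
      · exact hne l _ hlx
  -- At a non-periodic point every fixed return time is eventually excluded, so nothing needs to be
  -- set apart.
  · refine ⟨fun _ => ∅, 0, fun _ _ => MeasurableSet.empty, fun n => by simp, ?_, fun l hl => ?_⟩
    · simp [hnonper hx]
    · exact hne l _ fun hlx => hx ⟨l, hl, hlx⟩

end ShortReturns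

/-! ### What the polynomial and the exponential case supply. -/

section Cases

variable [MeasurableSpace Ω] {μ : Measure Ω} {T : Ω → Ω} {x : Ω} {U : ℕ → Set Ω} {γ : ℝ}
  {J : ℕ → ℝ} {p : ℝ}

theorem ApproxDecay.exists_bound {P : Set (Set Ω)} {side : Side}
    (h : ApproxDecay side μ T P x U γ) :
    ∃ K C : ℝ, 0 < K ∧ K ≤ 1 ∧ ∀ n j : ℕ, 1 ≤ n → 1 ≤ j → (j : ℝ) ≤ K * n →
      μ.real (sideApprox side T P n (U n) j) ≤ C * (j : ℝ) ^ (-γ) := by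
  obtain ⟨K, hK, hK1, C, hnon, hper⟩ := h
  refine ⟨K, C, hK, hK1, fun n j hn hj hjn => ?_⟩
  by_cases hx : x ∈ Function.periodicPts T
  · have h0 : overlap T (Function.minimalPeriod T x) (U n) 0 = U n := by
      ext y; simp [overlap]
    have := hper hx n 0 j hn hj (by simpa using hjn)
    rwa [h0, mul_zero, add_zero] at this
  · exact hnon hx n j hn hj hjn

theorem PolynomialCase.basic (h : PolynomialCase μ T x U γ J p) :
    1 < γ ∧ 1 < p ∧ (∀ n, 1 ≤ n → 0 < μ.real (U n)) ∧
      Tendsto (fun n : ℕ => n * μ.real (U n)) atTop (𝓝 0) := by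
  obtain ⟨γ₂, ζ, hγ, -, -, -, ⟨c, hc, hlow⟩, ⟨C, hup⟩, -, hp⟩ := h
  refine ⟨hγ, by linarith [(le_max_left _ _).trans_lt hp], fun n hn => ?_, ?_⟩
  · have : (0 : ℝ) < n := by exact_mod_cast hn
    exact lt_of_lt_of_le (by positivity) (hlow n hn)
  · have h1 : Tendsto (fun n : ℕ => C * (n : ℝ) ^ (-(γ - 1))) atTop (𝓝 0) := by
      simpa using ((tendsto_rpow_neg_atTop (by linarith : 0 < γ - 1)).comp
        tendsto_natCast_atTop_atTop).const_mul C
    refine tendsto_of_tendsto_of_tendsto_of_le_of_le' tendsto_const_nhds h1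
      (Eventually.of_forall fun n => by positivity) ?_
    filter_upwards [eventually_ge_atTop 1] with n hn
    have hn0 : (0 : ℝ) < n := by exact_mod_cast hn
    calc (n : ℝ) * μ.real (U n) ≤ n * (C * (n : ℝ) ^ (-γ)) := by gcongr; exact hup n hn
      _ = C * (n : ℝ) ^ (-(γ - 1)) := by
        rw [show -(γ - 1) = 1 + -γ by ring, Real.rpow_add hn0, Real.rpow_one]; ring

theorem ExponentialCase.basic (h : ExponentialCase μ T x U γ J p) :
    1 < γ ∧ 1 < p ∧ (∀ n, 1 ≤ n → 0 < μ.real (U n)) ∧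
      Tendsto (fun n : ℕ => n * μ.real (U n)) atTop (𝓝 0) := by
  obtain ⟨ξ₁, ξ₂, J₀, hγ, hξ₁, hξ, hξ₂, hJ, hJ1, ⟨c, hc, hlow⟩, ⟨C, hup⟩, -, hp⟩ := h
  have hξ₂0 := hξ₁.trans hξ
  refine ⟨hγ, ?_, fun n hn => lt_of_lt_of_le (by positivity) (hlow n hn), ?_⟩
  -- Both logarithms are negative, so the quotient is at least one and `p > 8 - 1`.
  · have h1 : 1 ≤ Real.log ξ₁ / Real.log ξ₂ := by
      rw [le_div_iff_of_neg (Real.log_neg hξ₂0 hξ₂), one_mul]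
      exact Real.log_le_log hξ₁ hξ.le
    have h2 : 8 ≤ 8 / J₀ := by
      rw [le_div_iff₀ hJ]; linarith
    nlinarith
  · have h1 : Tendsto (fun n : ℕ => C * (n * ξ₂ ^ n)) atTop (𝓝 0) := by
      simpa using (tendsto_self_mul_const_pow_of_lt_one hξ₂0.le hξ₂).const_mul C
    refine tendsto_of_tendsto_of_tendsto_of_le_of_le' tendsto_const_nhds h1
      (Eventually.of_forall fun n => by positivity) ?_
    filter_upwards [eventually_ge_atTop 1] with n hn
    calc (n : ℝ) * μ.real (U n) ≤ n * (C * ξ₂ ^ n) := by gcongr; exact hup n hn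
      _ = _ := by ring

end Cases

/-! ### From recurrences to exponential rates, for real sequences. -/

section Rates

/-- Iterating gives `f (k * L) ≤ Q ^ k ≤ exp (-k * (1 - Q))`; the strict inequality `hc` leaves
slack that absorbs the incomplete last block. -/
theorem eventually_le_exp {f : ℕ → ℝ} (hanti : Antitone f) (h0 : f 0 = 1)
    {L : ℕ} (hL : 0 < L) {Q c : ℝ} (hQ : 0 ≤ Q) (hstep : ∀ t, f (t + L) ≤ f t * Q)
    (hc : c * L < 1 - Q) : ∀ᶠ t : ℕ in atTop, f t ≤ Real.exp (-(c * t)) := by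
  rcases le_or_gt c 0 with hc0 | hc0
  · refine Eventually.of_forall fun t => ((hanti (Nat.zero_le t)).trans_eq h0).trans ?_
    exact Real.one_le_exp (neg_nonneg.2 (mul_nonpos_of_nonpos_of_nonneg hc0 t.cast_nonneg))
  have hpow : ∀ k : ℕ, f (k * L) ≤ Q ^ k := by
    intro k
    induction k with
    | zero => simp [h0]
    | succ k ih =>
      rw [add_mul, one_mul, pow_succ]
      exact (hstep _).trans (mul_le_mul_of_nonneg_right ih hQ)
  -- For `k ≥ K` this says `c * (k + 1) * L ≤ k * (1 - Q)`.
  obtain ⟨K, hK⟩ := exists_nat_ge (c * L / (1 - Q - c * L))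
  filter_upwards [eventually_ge_atTop (K * L)] with t ht
  set k := t / L with hk
  have hKk : K ≤ k := (Nat.le_div_iff_mul_le hL).2 ht
  have hkt : k * L ≤ t := Nat.div_mul_le_self t L
  have htk : (t : ℝ) ≤ (k + 1) * L := by
    exact_mod_cast (Nat.lt_mul_of_div_lt (Nat.lt_succ_self k) hL).le
  have hQe : Q ≤ Real.exp (-(1 - Q)) := by linarith [Real.add_one_le_exp (-(1 - Q))]
  calc f t ≤ Q ^ k := (hanti hkt).trans (hpow k)
    _ ≤ Real.exp (-(1 - Q)) ^ k := by gcongr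
    _ = Real.exp (k * -(1 - Q)) := (Real.exp_nat_mul _ _).symm
    _ ≤ _ := by
      refine Real.exp_le_exp.2 ?_
      have h1 : c * L / (1 - Q - c * L) ≤ k := hK.trans (by exact_mod_cast hKk)
      rw [div_le_iff₀ (by linarith)] at h1
      have h2 := mul_le_mul_of_nonneg_left htk hc0.le
      linarith

/-- The two-step recurrence reduces to the ratio bound `q * f t ≤ f (t + L)` along multiples of `L`.
Inductively, `q ≥ 1 / 2` gives `f t ≤ 2 * f (t + L)`, so the subtracted term costs at most `2 * β`
of the factor `α`, and `α - 2 * β ≥ q` carries the bound on. -/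
theorem eventually_exp_le {f : ℕ → ℝ} (hanti : Antitone f) (h0 : f 0 = 1) (hf : ∀ t, 0 ≤ f t)
    {L : ℕ} (hL : 0 < L) {q α β c : ℝ} (hq : 1 / 2 ≤ q) (hqL : q ≤ f L) (hqα : q ≤ α - 2 * β)
    (hβ : 0 ≤ β) (hstep : ∀ t, f (t + L) * α - f t * β ≤ f (t + L + L))
    (hc : 1 - q < c * L * q) : ∀ᶠ t : ℕ in atTop, Real.exp (-(c * t)) ≤ f t := by
  have hq0 : 0 < q := by linarith
  have hq1 : q ≤ 1 := hqL.trans ((hanti (Nat.zero_le L)).trans_eq h0)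
  have hratio : ∀ k : ℕ, q * f (k * L) ≤ f (k * L + L) := by
    intro k
    induction k with
    | zero => simpa [h0] using hqL
    | succ k ih =>
      rw [add_mul, one_mul]
      have h1 := hstep (k * L)
      have h2 := hf (k * L + L)
      have h3 : f (k * L) ≤ 2 * f (k * L + L) := by nlinarith [hf (k * L)]
      have h4 := mul_le_mul_of_nonneg_right h3 hβ
      have h5 := mul_le_mul_of_nonneg_right hqα h2
      linarith
  have hpow : ∀ k : ℕ, q ^ k ≤ f (k * L) := by
    intro k
    induction k with
    | zero => simp [h0]
    | succ k ih =>
      rw [add_mul, one_mul, pow_succ, mul_comm]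
      exact (mul_le_mul_of_nonneg_left ih hq0.le).trans (hratio k)
  -- Chosen so that `exp (-d) ≤ q`; `hc` then reads `d < c * L`.
  set d := 1 / q - 1 with hd
  have hdq : Real.exp (-d) ≤ q := by
    have h1 : 1 / q ≤ Real.exp d := by linarith [Real.add_one_le_exp d]
    rw [Real.exp_neg]
    exact inv_le_of_inv_le₀ hq0 (by simpa using h1)
  have hdc : d < c * L := by
    rw [hd, sub_lt_iff_lt_add, div_lt_iff₀ hq0]
    linarith
  have hd0 : 0 ≤ d := by
    rw [hd, sub_nonneg, le_div_iff₀ hq0]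
    linarith
  have hc0 : 0 < c := pos_of_mul_pos_left (hd0.trans_lt hdc) L.cast_nonneg
  -- For `k ≥ K` this says `(k + 1) * d ≤ k * c * L`.
  obtain ⟨K, hK⟩ := exists_nat_ge (d / (c * L - d))
  filter_upwards [eventually_ge_atTop (K * L)] with t ht
  set k := t / L with hk
  have hKk : K ≤ k := (Nat.le_div_iff_mul_le hL).2 ht
  have hkt : (k : ℝ) * L ≤ t := by exact_mod_cast Nat.div_mul_le_self t L
  have htk : t ≤ (k + 1) * L := (Nat.lt_mul_of_div_lt (Nat.lt_succ_self k) hL).le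
  calc Real.exp (-(c * t)) ≤ Real.exp ((k + 1 : ℕ) * -d) := by
        refine Real.exp_le_exp.2 ?_
        have h1 : d / (c * L - d) ≤ k := hK.trans (by exact_mod_cast hKk)
        rw [div_le_iff₀ (by linarith)] at h1
        have h2 := mul_le_mul_of_nonneg_left hkt hc0.le
        push_cast
        linarith
    _ = Real.exp (-d) ^ (k + 1) := Real.exp_nat_mul _ _
    _ ≤ q ^ (k + 1) := by gcongr
    _ ≤ f ((k + 1) * L) := hpow _
    _ ≤ f t := hanti htk

theorem tendsto_natCeil_div_mul {u : ℕ → ℝ} (hpos : ∀ᶠ n in atTop, 0 < u n)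
    (hu : Tendsto u atTop (𝓝 0)) {a : ℝ} (ha : 0 ≤ a) :
    Tendsto (fun n => (⌈a / u n⌉₊ : ℝ) * u n) atTop (𝓝 a) := by
  have h1 : Tendsto (fun n => a + u n) atTop (𝓝 a) := by simpa using hu.const_add a
  refine tendsto_of_tendsto_of_tendsto_of_le_of_le' tendsto_const_nhds h1 ?_ ?_
  · filter_upwards [hpos] with n hn
    rw [← div_le_iff₀ hn]
    exact Nat.le_ceil _
  · filter_upwards [hpos] with n hn
    have := (Nat.ceil_lt_add_one (div_nonneg ha hn.le)).le
    calc (⌈a / u n⌉₊ : ℝ) * u n ≤ (a / u n + 1) * u n := by gcongr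
      _ = a + u n := by field_simp

/-- With `ε` fixed and `n → ∞`, the quantities `s * u`, `Δ * u`, `n * u` and `φ Δ` tend to `ε`,
`ε²`, `0` and `0`. The hypotheses of `eventually_le_exp` and `eventually_exp_le` thus become strict
inequalities between limits, polynomial in `ε`, with main term `ε * η` against errors of order `ε²`.
-/
theorem eventually_exp_bounds_of_recurrence {f : ℕ → ℕ → ℝ} {u θ φ : ℕ → ℝ} {ϑ : ℝ} {m : ℕ}
    (hanti : ∀ n, Antitone (f n)) (h0 : ∀ n, f n 0 = 1) (hf : ∀ n t, 0 ≤ f n t)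
    (hpos : ∀ n, 1 ≤ n → 0 < u n) (hu : Tendsto (fun n : ℕ => n * u n) atTop (𝓝 0))
    (hφ : Tendsto φ atTop (𝓝 0)) (hφ0 : ∀ k, 0 ≤ φ k)
    (hθ : Tendsto θ atTop (𝓝 ϑ)) (hθ0 : ∀ n, 0 ≤ θ n) (hθ1 : ∀ n, θ n ≤ 1)
    (hup : ∀ n, 1 ≤ n → ∀ t s Δ, f n (t + (n + Δ + s)) ≤ f n t * (f n s + φ Δ))
    (hlow : ∀ n, 1 ≤ n → ∀ t s Δ, f n (t + (n + Δ + s)) * (f n s - φ Δ) -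
      f n t * ((n + Δ : ℕ) * u n + φ Δ) ≤ f n (t + (n + Δ + s) + (n + Δ + s)))
    (hle : ∀ n, 1 ≤ n → ∀ s : ℕ, 1 - f n s ≤ m * u n + s * (u n * (1 - θ n)))
    (hge : ∀ δ > 0, ∀ᶠ n in atTop, ∀ s : ℕ,
      s * (u n * (1 - θ n - δ - s * u n)) ≤ 1 - f n s) {η : ℝ} (hη : 0 < η) :
    ∀ᶠ n in atTop, (∀ᶠ t : ℕ in atTop, f n t ≤ Real.exp (-((1 - ϑ - η) * u n * t))) ∧
      ∀ᶠ t : ℕ in atTop, Real.exp (-((1 - ϑ + η) * u n * t)) ≤ f n t := by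
  have hϑ0 : 0 ≤ ϑ := ge_of_tendsto' hθ hθ0
  have hϑ1 : ϑ ≤ 1 := le_of_tendsto' hθ hθ1
  obtain ⟨ε, hε, hε1, hεη⟩ : ∃ ε : ℝ, 0 < ε ∧ ε ≤ 1 / 16 ∧ ε ≤ η / 16 :=
    ⟨min (1 / 16) (η / 16), by positivity, min_le_left _ _, min_le_right _ _⟩
  have hpos' : ∀ᶠ n in atTop, 0 < u n := by
    filter_upwards [eventually_ge_atTop 1] with n hn using hpos n hn
  have hu0 : Tendsto u atTop (𝓝 0) := by
    refine tendsto_of_tendsto_of_tendsto_of_le_of_le' tendsto_const_nhds hu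
      (hpos'.mono fun n hn => hn.le) ?_
    filter_upwards [eventually_ge_atTop 1] with n hn
    exact le_mul_of_one_le_left (hpos n hn).le (by exact_mod_cast hn)
  set s : ℕ → ℕ := fun n => ⌈ε / u n⌉₊ with hs
  set Δ : ℕ → ℕ := fun n => ⌈ε ^ 2 / u n⌉₊ with hΔ
  have hsu : Tendsto (fun n => (s n : ℝ) * u n) atTop (𝓝 ε) :=
    tendsto_natCeil_div_mul hpos' hu0 hε.le
  have hΔu : Tendsto (fun n => (Δ n : ℝ) * u n) atTop (𝓝 (ε ^ 2)) :=
    tendsto_natCeil_div_mul hpos' hu0 (by positivity)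
  have hΔtop : Tendsto Δ atTop atTop := by
    refine tendsto_nat_ceil_atTop.comp ?_
    refine Tendsto.const_mul_atTop (by positivity) (tendsto_inv_nhdsGT_zero.comp ?_)
    exact tendsto_nhdsWithin_iff.2 ⟨hu0, hpos'⟩
  have hφΔ : Tendsto (fun n => φ (Δ n)) atTop (𝓝 0) := hφ.comp hΔtop
  have hgu : Tendsto (fun n => (n * u n + Δ n * u n : ℝ)) atTop (𝓝 (ε ^ 2)) := by
    simpa using hu.add hΔu
  have hLu := hgu.add hsu
  have hθ' : Tendsto (fun n => 1 - θ n) atTop (𝓝 (1 - ϑ)) := hθ.const_sub 1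
  -- A lower bound for `1 - Q - c * L`, where `Q = f n (s n) + φ (Δ n)`, `L = n + Δ n + s n` and `c
  -- = (1 - ϑ - η) * u n`.
  have hlim1 : Tendsto (fun n => s n * u n * (1 - θ n - ε - s n * u n) - φ (Δ n)
      - (1 - ϑ - η) * (n * u n + Δ n * u n + s n * u n)) atTop
      (𝓝 (ε * (1 - ϑ - ε - ε) - 0 - (1 - ϑ - η) * (ε ^ 2 + ε))) :=
    ((hsu.mul ((hθ'.sub_const ε).sub hsu)).sub hφΔ).sub (hLu.const_mul _)
  -- A common lower bound for `f n L` and `α - 2 * β`, where `α = f n (s n) - φ (Δ n)` and `β = (n +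
  -- Δ n) * u n + φ (Δ n)`; this accounts for the factors `3` and `2`.
  set q : ℕ → ℝ := fun n => 1 - (m * u n + s n * u n * (1 - θ n) + 3 * φ (Δ n) +
    2 * (n * u n + Δ n * u n)) with hq
  have hqlim : Tendsto q atTop
      (𝓝 (1 - (m * 0 + ε * (1 - ϑ) + 3 * 0 + 2 * ε ^ 2))) :=
    ((((hu0.const_mul _).add (hsu.mul hθ')).add (hφΔ.const_mul 3)).add
      (hgu.const_mul 2)).const_sub 1
  -- The slack `c * L * q - (1 - q)` for `c = (1 - ϑ + η) * u n`.
  have hlim2 := (((hLu.const_mul (1 - ϑ + η)).mul hqlim).sub (hqlim.const_sub 1))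
  have hε2 : ε ^ 2 ≤ ε / 16 := by nlinarith
  have hw0 : 0 ≤ 1 - ϑ := by linarith
  have hw1 : 1 - ϑ ≤ 1 := by linarith
  generalize 1 - ϑ = w at *
  have hpos1 : 0 < ε * (w - ε - ε) - 0 - (w - η) * (ε ^ 2 + ε) := by
    have : 0 < ε * (η * (1 + ε) - 2 * ε - w * ε) := by
      refine mul_pos hε ?_
      nlinarith [mul_nonneg hη.le hε.le]
    linarith
  have hqpos : 1 / 2 < 1 - (m * 0 + ε * w + 3 * 0 + 2 * ε ^ 2) := by nlinarith
  have hpos2 : 0 < (w + η) * (ε ^ 2 + ε) * (1 - (m * 0 + ε * w + 3 * 0 + 2 * ε ^ 2)) -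
      (1 - (1 - (m * 0 + ε * w + 3 * 0 + 2 * ε ^ 2))) := by
    have h1 : 1 - 5 * ε ^ 2 ≤ (1 + ε) * (1 - ε * w - 2 * ε ^ 2) := by
      nlinarith [mul_nonneg hε.le (sub_nonneg.2 hw1), pow_pos hε 2, pow_pos hε 3]
    have h2 : (w + η) * (1 - 5 * ε ^ 2) ≤ (w + η) * ((1 + ε) * (1 - ε * w - 2 * ε ^ 2)) :=
      mul_le_mul_of_nonneg_left h1 (by linarith)
    have h3 : ε ^ 2 * η ≤ η / 256 := by nlinarith
    have h4 : ε ^ 2 * w ≤ ε ^ 2 := by nlinarith [pow_pos hε 2]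
    have h5 : 0 < (w + η) * ((1 + ε) * (1 - ε * w - 2 * ε ^ 2)) - (w + 2 * ε) := by
      nlinarith
    have h6 := mul_pos hε h5
    linarith
  filter_upwards [eventually_ge_atTop 1, hge ε hε, hlim1.eventually_const_lt hpos1,
    hqlim.eventually_const_lt hqpos, hlim2.eventually_const_lt hpos2] with n hn hgen h1 h2 h3
  have hun := hpos n hn
  have hL : 0 < n + Δ n + s n := by omega
  have hcast : ((n + Δ n + s n : ℕ) : ℝ) * u n = n * u n + Δ n * u n + s n * u n := by
    push_cast; ring
  have hcast' : ((n + Δ n : ℕ) : ℝ) * u n = n * u n + Δ n * u n := by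
    push_cast; ring
  have hφn := hφ0 (Δ n)
  have hgn : 0 ≤ n * u n + Δ n * u n := by positivity
  constructor
  · refine eventually_le_exp (hanti n) (h0 n) hL (Q := f n (s n) + φ (Δ n))
      (add_nonneg (hf _ _) (hφ0 _)) (fun t => hup n hn t _ _) ?_
    have h4 := hgen (s n)
    have h5 : (w - η) * u n * ((n + Δ n + s n : ℕ) : ℝ) =
        (w - η) * (n * u n + Δ n * u n + s n * u n) := by rw [← hcast]; ring
    rw [h5]
    linarith
  · refine eventually_exp_le (hanti n) (h0 n) (hf n) hL (q := q n)
      (α := f n (s n) - φ (Δ n)) (β := (n + Δ n : ℕ) * u n + φ (Δ n)) h2.le ?_ ?_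
      (by positivity) (fun t => hlow n hn t _ _) ?_
    · have h4 := hle n hn (n + Δ n + s n)
      have h5 : ((n + Δ n + s n : ℕ) : ℝ) * (u n * (1 - θ n)) =
          (n * u n + Δ n * u n) * (1 - θ n) + s n * u n * (1 - θ n) := by
        push_cast; ring
      have h6 : (n * u n + Δ n * u n) * (1 - θ n) ≤ n * u n + Δ n * u n :=
        mul_le_of_le_one_right hgn (by linarith [hθ0 n])
      simp only [hq]
      linarith
    · have h4 := hle n hn (s n)
      rw [hcast']
      simp only [hq]
      linarith
    · have h5 : (w + η) * u n * ((n + Δ n + s n : ℕ) : ℝ) =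
          (w + η) * (n * u n + Δ n * u n + s n * u n) := by rw [← hcast]; ring
      rw [h5]
      linarith

end Rates

/-! ### From exponential bounds to escape rates in `EReal`. -/

section EscapeRates

/-- Entry times are counted from one and `avoid` from zero; the resulting shift by `T` is invisible
to an invariant measure. -/
theorem setOf_lt_entryTime (T : Ω → Ω) (U : Set Ω) (t : ℕ) :
    {y | (t : ℕ∞) < entryTime T U y} = T^[1] ⁻¹' avoid T U t := by
  ext y
  rw [mem_ofPred_eq, ← ENat.add_one_le_iff (ENat.natCast_ne_top t), entryTime, le_iInf₂_iff]
  simp only [avoid, mem_preimage, mem_ofPred_eq]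
  constructor
  · intro h j hj hjU
    rw [← Function.iterate_add_apply] at hjU
    have : t + 1 ≤ j + 1 := by exact_mod_cast h (j + 1) ⟨by omega, hjU⟩
    omega
  · rintro h j ⟨hj, hjU⟩
    by_contra hlt
    have hjt : j < t + 1 := by exact_mod_cast not_le.1 hlt
    refine h (j - 1) (by omega) ?_
    rwa [← Function.iterate_add_apply, Nat.sub_add_cancel hj]

variable [MeasurableSpace Ω] {μ : Measure Ω} [IsProbabilityMeasure μ] {T : Ω → Ω} {U : Set Ω}

/-- Passing through `ENNReal.ofReal` keeps a vanishing survival probability, whose logarithm is `⊥`,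
within the same formula. -/
theorem escapeExponent_eq (hT : MeasurePreserving T μ μ) (hU : MeasurableSet U) (t : ℕ) :
    escapeExponent μ T U t =
      -ENNReal.log (ENNReal.ofReal (μ.real (avoid T U t))) / ((t : ℝ) : EReal) := by
  rw [escapeExponent, setOf_lt_entryTime, (hT.iterate 1).measure_preimage
    (measurableSet_avoid' hT.measurable hU t).nullMeasurableSet, ofReal_measureReal]
  rfl

theorem le_escapeExponent (hT : MeasurePreserving T μ μ) (hU : MeasurableSet U) {t : ℕ}
    (ht : 1 ≤ t) {c : ℝ} (h : μ.real (avoid T U t) ≤ Real.exp (-(c * t))) :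
    (c : EReal) ≤ escapeExponent μ T U t := by
  have ht0 : (0 : EReal) < ((t : ℝ) : EReal) := by exact_mod_cast ht
  rw [escapeExponent_eq hT hU, EReal.le_div_iff_mul_le ht0 (EReal.coe_ne_top _), EReal.le_neg]
  refine (ENNReal.log_monotone (ENNReal.ofReal_le_ofReal h)).trans_eq ?_
  rw [ENNReal.log_ofReal_of_pos (Real.exp_pos _), Real.log_exp]
  push_cast
  rfl

theorem escapeExponent_le (hT : MeasurePreserving T μ μ) (hU : MeasurableSet U) {t : ℕ}
    (ht : 1 ≤ t) {c : ℝ} (h : Real.exp (-(c * t)) ≤ μ.real (avoid T U t)) :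
    escapeExponent μ T U t ≤ c := by
  have ht0 : (0 : EReal) < ((t : ℝ) : EReal) := by exact_mod_cast ht
  rw [escapeExponent_eq hT hU, EReal.div_le_iff_le_mul ht0 (EReal.coe_ne_top _), EReal.neg_le]
  refine Eq.trans_le ?_ (ENNReal.log_monotone (ENNReal.ofReal_le_ofReal h))
  rw [ENNReal.log_ofReal_of_pos (Real.exp_pos _), Real.log_exp]
  push_cast
  rw [mul_comm]

theorem tendsto_div_of_eventually_mem_Icc {R : ℕ → EReal} {u : ℕ → ℝ} {w : ℝ}
    (hpos : ∀ n, 1 ≤ n → 0 < u n)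
    (h : ∀ η > 0, ∀ᶠ n in atTop,
      (((w - η) * u n : ℝ) : EReal) ≤ R n ∧ R n ≤ (((w + η) * u n : ℝ) : EReal)) :
    Tendsto (fun n => R n / (u n : EReal)) atTop (𝓝 (w : EReal)) := by
  have hdiv : ∀ η > 0, ∀ᶠ n in atTop, ((w - η : ℝ) : EReal) ≤ R n / (u n : EReal) ∧
      R n / (u n : EReal) ≤ ((w + η : ℝ) : EReal) := by
    intro η hη
    filter_upwards [h η hη, eventually_ge_atTop 1] with n hn hn1
    have hu : (0 : EReal) < u n := by exact_mod_cast hpos n hn1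
    rw [EReal.le_div_iff_mul_le hu (EReal.coe_ne_top _),
      EReal.div_le_iff_le_mul hu (EReal.coe_ne_top _), ← EReal.coe_mul, ← EReal.coe_mul,
      mul_comm (u n)]
    exact hn
  refine tendsto_order.2 ⟨fun a ha => ?_, fun a ha => ?_⟩
  · obtain ⟨r, har, hrw⟩ := EReal.lt_iff_exists_real_btwn.1 ha
    filter_upwards [hdiv (w - r) (sub_pos.2 (by exact_mod_cast hrw))] with n hn
    rw [sub_sub_cancel] at hn
    exact har.trans_le hn.1
  · obtain ⟨r, hrw, har⟩ := EReal.lt_iff_exists_real_btwn.1 ha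
    filter_upwards [hdiv (r - w) (sub_pos.2 (by exact_mod_cast hrw))] with n hn
    rw [add_sub_cancel] at hn
    exact hn.2.trans_lt har

end EscapeRates

/-! ### Assembly for adapted neighbourhood systems. -/

section Adapted

variable [MeasurableSpace Ω] [TopologicalSpace Ω] [T2Space Ω] {μ : Measure Ω}
  [IsProbabilityMeasure μ] {T : Ω → Ω} {P : Set (Set Ω)} {side : Side} {φ : ℕ → ℝ} {p : ℝ}
  {x : Ω} {U : ℕ → Set Ω} {γ : ℝ} {J : ℕ → ℝ} {ϑ : ℝ}

/-- Exponential bounds for the probability of not having entered `U n` by a long time. -/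
theorem IsAdapted.eventually_exp_bounds (hU : IsAdapted side μ T P x U γ J)
    (hT : MeasurePreserving T μ μ) (hP : IsMeasPartition P) (hφ : PhiMixing side μ T P φ)
    (hdecay : PolyDecay φ p) (hp : 1 < p) (hγ : 1 < γ) (hcont : ∀ k : ℕ, ContinuousAt (T^[k]) x)
    (hpos : ∀ n, 1 ≤ n → 0 < μ.real (U n))
    (hsmall : Tendsto (fun n : ℕ => n * μ.real (U n)) atTop (𝓝 0))
    (hnonper : x ∉ Function.periodicPts T → ϑ = 0)
    (hper : x ∈ Function.periodicPts T →
      Tendsto (fun n => μ.real (U n ∩ T^[Function.minimalPeriod T x] ⁻¹' (U n)) / μ.real (U n))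
        atTop (𝓝 ϑ)) {η : ℝ} (hη : 0 < η) :
    ∀ᶠ n in atTop,
      (∀ᶠ t : ℕ in atTop,
        μ.real (avoid T (U n) t) ≤ Real.exp (-((1 - ϑ - η) * μ.real (U n) * t))) ∧
      ∀ᶠ t : ℕ in atTop,
        Real.exp (-((1 - ϑ + η) * μ.real (U n) * t)) ≤ μ.real (avoid T (U n) t) := by
  have hUm : ∀ n, 1 ≤ n → MeasurableSet (U n) := fun n hn =>
    sigmaCyl_le hP hT.measurable _ (hU.measurable n hn)
  obtain ⟨D, m, hD, hdisj, hϑ, hshort⟩ :=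
    hU.exists_short_returns hT.measurable hUm hpos hcont hnonper hper
  obtain ⟨K, C, hK, hK1, happrox⟩ := hU.decay.exists_bound
  obtain ⟨b, hb, M, hM⟩ := hφ.exists_summable_return_bound hP hdecay hp hγ hK hK1
    hU.measurable happrox
  have hθmul : ∀ n, 1 ≤ n → μ.real (U n) * (μ.real (U n ∩ D n) / μ.real (U n)) =
      μ.real (U n ∩ D n) := fun n hn => mul_div_cancel₀ _ (hpos n hn).ne'
  refine eventually_exp_bounds_of_recurrence (f := fun n t => μ.real (avoid T (U n) t))
    (u := fun n => μ.real (U n)) (θ := fun n => μ.real (U n ∩ D n) / μ.real (U n)) (m := m)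
    (fun n a b hab => measureReal_mono (avoid_anti hab)) (fun n => measureReal_avoid_zero)
    (fun _ _ => measureReal_nonneg) hpos hsmall hφ.tendsto hφ.nonneg hϑ
    (fun n => by positivity)
    (fun n => div_le_one_of_le₀ (measureReal_mono inter_subset_left) measureReal_nonneg)
    (fun n hn t s Δ => hφ.avoid_le hP (hU.measurable n hn) t s Δ)
    (fun n hn t s Δ => hφ.le_avoid hP hT (hU.measurable n hn) t s Δ) (fun n hn s => ?_)
    (fun δ hδ => ?_) hη
  · have := one_sub_measureReal_avoid_le_of_disjoint hT (hUm n hn) (hD n hn) (hdisj n) s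
    rwa [mul_one_sub, hθmul n hn]
  · filter_upwards [sum_measureReal_returns_le hb hM hpos hshort hδ, eventually_ge_atTop 1]
      with n hn hn1 s
    refine le_trans ?_ (le_one_sub_measureReal_avoid hT (hUm n hn1) (D n) s)
    refine mul_le_mul_of_nonneg_left ?_ s.cast_nonneg
    have h1 := hn s
    have h2 := hθmul n hn1
    linarith

end Adapted

end EscapeRate

theorem theorem1 {Ω : Type*} [MeasurableSpace Ω] [TopologicalSpace Ω] [T2Space Ω]
    (μ : Measure Ω) [IsProbabilityMeasure μ] (T : Ω → Ω) (hT : MeasurePreserving T μ μ)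
    (P : Set (Set Ω)) (hP : IsMeasPartition P) (hgen : IsGenerating T P)
    (side : Side) (φ : ℕ → ℝ) (hφ : PhiMixing side μ T P φ) (p : ℝ) (hp : PolyDecay φ p)
    (x : Ω) (hcont : ∀ k : ℕ, ContinuousAt (T^[k]) x)
    (U : ℕ → Set Ω) (γ : ℝ) (J : ℕ → ℝ) (hU : IsAdapted side μ T P x U γ J)
    (hcase : PolynomialCase μ T x U γ J p ∨ ExponentialCase μ T x U γ J p)
    (ϑ : ℝ) (hnonper : x ∉ Function.periodicPts T → ϑ = 0)
    (hper : x ∈ Function.periodicPts T →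
      Tendsto (fun n => μ.real (U n ∩ T^[Function.minimalPeriod T x] ⁻¹' (U n)) / μ.real (U n))
        atTop (𝓝 ϑ) ∧ ϑ < 1 / 2) :
    Tendsto (fun n => lowerEscapeRate μ T (U n) / (μ.real (U n) : EReal)) atTop
        (𝓝 ((1 - ϑ : ℝ) : EReal)) ∧
      Tendsto (fun n => upperEscapeRate μ T (U n) / (μ.real (U n) : EReal)) atTop
        (𝓝 ((1 - ϑ : ℝ) : EReal)) ∧
      ∀ ρ : ℕ → EReal, (∀ᶠ n in atTop, HasEscapeRate μ T (U n) (ρ n)) →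
        Tendsto (fun n => ρ n / (μ.real (U n) : EReal)) atTop (𝓝 ((1 - ϑ : ℝ) : EReal)) := by
  obtain ⟨hγ, hp1, hpos, hsmall⟩ := hcase.elim PolynomialCase.basic ExponentialCase.basic
  have hUm : ∀ n, 1 ≤ n → MeasurableSet (U n) := fun n hn =>
    sigmaCyl_le hP hT.measurable _ (hU.measurable n hn)
  have hmain : ∀ η > 0, ∀ᶠ n in atTop,
      (((1 - ϑ - η) * μ.real (U n) : ℝ) : EReal) ≤ lowerEscapeRate μ T (U n) ∧
        upperEscapeRate μ T (U n) ≤ (((1 - ϑ + η) * μ.real (U n) : ℝ) : EReal) := by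
    intro η hη
    filter_upwards [hU.eventually_exp_bounds hT hP hφ hp hp1 hγ hcont hpos hsmall hnonper
      (fun hx => (hper hx).1) hη, eventually_ge_atTop 1] with n hn hn1
    constructor
    · refine le_liminf_of_le (by isBoundedDefault) ?_
      filter_upwards [hn.1, eventually_ge_atTop 1] with t ht ht1
      exact le_escapeExponent hT (hUm n hn1) ht1 ht
    · refine limsup_le_of_le (by isBoundedDefault) ?_
      filter_upwards [hn.2, eventually_ge_atTop 1] with t ht ht1
      exact escapeExponent_le hT (hUm n hn1) ht1 ht
  -- The lower rate is bounded below and the upper rate above, so their order encloses both.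
  have hle : ∀ n, lowerEscapeRate μ T (U n) ≤ upperEscapeRate μ T (U n) :=
    fun n => liminf_le_limsup
  have hlower : Tendsto (fun n => lowerEscapeRate μ T (U n) / (μ.real (U n) : EReal)) atTop
      (𝓝 ((1 - ϑ : ℝ) : EReal)) :=
    tendsto_div_of_eventually_mem_Icc hpos fun η hη =>
      (hmain η hη).mono fun n hn => ⟨hn.1, (hle n).trans hn.2⟩
  refine ⟨hlower, ?_, fun ρ hρ => hlower.congr' ?_⟩
  · exact tendsto_div_of_eventually_mem_Icc hpos fun η hη =>
      (hmain η hη).mono fun n hn => ⟨hn.1.trans (hle n), hn.2⟩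
  · filter_upwards [hρ] with n hn
    rw [lowerEscapeRate, Tendsto.liminf_eq hn]
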